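/- Let $d\ge 1$, let $A$ be a complex $d\times d$ matrix, and for $\theta\in\mathbb R$ put $A(\theta)=\Re(e^{-i\theta}A)$, where $\Re(B)=\frac12(B+B^*)$, and let $A'(\theta)$ be its derivative with respect to $\theta$. Let $\lambda_{\rm m}(\theta)$ be the largest eigenvalue of the hermitian matrix $A(\theta)$ and $X_{\rm m}(\theta)\subset\mathbb C^d$ the corresponding eigenspace. For $v=\pm1$ let $\lambda_{\rm m}'(\theta;v)=\lim_{t\to0^+}\frac1t\big(\lambda_{\rm m}(\theta+tv)-\lambda_{\rm m}(\theta)\big)$. For a subspace $X\subset\mathbb C^d$ with orthogonal projection $P$ let $B|_X$ denote the restriction of $PBP$ to $X$, as an operator on $X$. Let $\lambda_1,\dots,\lambda_d:\mathbb R\to\mathbb R$ and $x_1,\dots,x_d:\mathbb R\to\mathbb C^d$ be real-analytic such that for every $\theta\in\mathbb R$ the vectors $x_1(\theta),\dots,x_d(\theta)$ are orthonormal and $A(\theta)x_k(\theta)=\lambda_k(\theta)x_k(\theta)$ for all $k$. Then for every $\theta\in\mathbb R$ and each choice of the sign $\pm$, the limit $\lambda_{\rm m}'(\theta;\pm1)$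 exists, the number $\pm\lambda_{\rm m}'(\theta;\pm1)$ is an eigenvalue of $A'(\theta)|_{X_{\rm m}(\theta)}$, and its eigenspace $X_\pm(\theta)\subset X_{\rm m}(\theta)$ satisfies $$X_\pm(\theta)=\operatorname{span}\{x_k(\theta)\mid 1\le k\le d,\ \lambda_k(\theta)=\lambda_{\rm m}(\theta),\ \lambda_k'(\theta)=\pm\lambda_{\rm m}'(\theta;\pm1)\}.$$ -/

import Mathlib

open Filter Topology

namespace NumRange

/-- The hermitian matrix `A(θ) = Re(e^{-iθ} A)`, where `Re(B) = (B + B*) / 2`. -/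
noncomputable def rotRe {d : ℕ} (A : Matrix (Fin d) (Fin d) ℂ) (θ : ℝ) :
    Matrix (Fin d) (Fin d) ℂ :=
  ((realPart (Complex.exp (-(Complex.I * (θ : ℂ))) • A) :
    selfAdjoint (Matrix (Fin d) (Fin d) ℂ)) : Matrix (Fin d) (Fin d) ℂ)

/-- The (entrywise) derivative `A'(θ)` of `θ ↦ A(θ)`. -/
noncomputable def rotReDeriv {d : ℕ} (A : Matrix (Fin d) (Fin d) ℂ) (θ : ℝ) :
    Matrix (Fin d) (Fin d) ℂ :=
  Matrix.of fun i j => deriv (fun t : ℝ => rotRe A t i j) θ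

/-- The largest eigenvalue of `A(θ)`. -/
noncomputable def lamMax {d : ℕ} (A : Matrix (Fin d) (Fin d) ℂ) (θ : ℝ) : ℝ :=
  sSup {μ : ℝ | Module.End.HasEigenvalue (Matrix.toEuclideanLin (rotRe A θ)) (μ : ℂ)}

/-- The eigenspace `X_m(θ)` of `A(θ)` for its largest eigenvalue. -/
noncomputable def maxEigenspace {d : ℕ} (A : Matrix (Fin d) (Fin d) ℂ) (θ : ℝ) :
    Submodule ℂ (EuclideanSpace ℂ (Fin d)) :=
  Module.End.eigenspace (Matrix.toEuclideanLin (rotRe A θ)) (lamMax A θ : ℂ)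

/-- The directional derivative of `f` at `u` in direction `v` exists and equals `L`:
`(f (u + t v) - f u) / t → L` as `t → 0+`. -/
def HasDirDeriv (f : ℝ → ℝ) (u v L : ℝ) : Prop :=
  Tendsto (fun t : ℝ => (1 / t) * (f (u + t * v) - f u)) (𝓝[>] 0) (𝓝 L)

/-- The directional derivative `f'(u; v)`, the limit of `(f (u + t v) - f u) / t` as `t → 0+`. -/
noncomputable def dirDeriv (f : ℝ → ℝ) (u v : ℝ) : ℝ :=
  limUnder (𝓝[>] 0) (fun t : ℝ => (1 / t) * (f (u + t * v) - f u))

/-- The compression `B|_X` of the matrix `B` onto the subspace `X`: the restriction of `P B P`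
to `X`, as an operator on `X`, where `P` is the orthogonal projection onto `X`. -/
noncomputable def compression {d : ℕ} (B : Matrix (Fin d) (Fin d) ℂ)
    (X : Submodule ℂ (EuclideanSpace ℂ (Fin d))) : X →ₗ[ℂ] X :=
  (X.orthogonalProjectionOnto : EuclideanSpace ℂ (Fin d) →ₗ[ℂ] X) ∘ₗ
    Matrix.toEuclideanLin B ∘ₗ X.subtype

/-- For `σ = 1` or `σ = -1`, the number `σ λ_m'(θ; σ)`. -/
noncomputable def extremeValue {d : ℕ} (A : Matrix (Fin d) (Fin d) ℂ) (θ σ : ℝ) : ℝ :=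
  σ * dirDeriv (lamMax A) θ σ

/-- For `σ = 1` or `σ = -1`, the space `X_±(θ)`: the eigenspace of the compression
`A'(θ)|_{X_m(θ)}` for the value `σ λ_m'(θ; σ)`, as a subspace of `ℂ^d`. -/
noncomputable def extremeEigenspace {d : ℕ} (A : Matrix (Fin d) (Fin d) ℂ) (θ σ : ℝ) :
    Submodule ℂ (EuclideanSpace ℂ (Fin d)) :=
  Submodule.map (maxEigenspace A θ).subtype
    (Module.End.eigenspace (compression (rotReDeriv A θ) (maxEigenspace A θ))
      (extremeValue A θ σ : ℂ))

end NumRange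

/-!
In the orthonormal basis `x k θ` the matrix `A(θ)` is diagonal with entries `lam k θ`, so the largest
eigenvalue is the maximum of finitely many differentiable functions, and `X_m(θ)` is spanned by
the `x k θ` with `k` active, meaning `lam k θ = λ_m(θ)`. A finite maximum has one-sided
derivatives, the derivative in direction `σ` being the maximum of `σ * lam' k θ` over the active `k`
(`hasDirDeriv_of_isGreatest`).

On the other side, differentiating `A(t) x_k(t) = λ_k(t) x_k(t)` and pairing with `x_j(θ)`, where
`λ_j(θ) = λ_k(θ)`, the two terms containing `x_k'` cancel by symmetry of `A(θ)`, leaving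
`⟪x_j, A'(θ) x_k⟫ = λ_k'(θ) δ_jk` (`inner_rotReDeriv_eigenvector`). Hence the compression of `A'(θ)`
to `X_m(θ)` is diagonal in the active vectors with entries `lam' k θ`, and both its eigenvalues and its
eigenspaces can be read off (`eigenspace_eq_span_of_basis`, `hasEigenvalue_iff_of_basis`).
-/

open Filter Topology

namespace NumRange

theorem eigenspace_eq_span_of_basis {K V ι : Type*} [Field K] [AddCommGroup V] [Module K V]
    (b : Module.Basis ι K V) (S : V →ₗ[K] V) (c : ι → K) (h : ∀ i, S (b i) = c i • b i) (μ : K) :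
    Module.End.eigenspace S μ = Submodule.span K (b '' {i | c i = μ}) := by
  have hrepr : ∀ v i, b.repr (S v) i = c i * b.repr v i := by
    intro v i
    have : (b.coord i) ∘ₗ S = c i • b.coord i := by
      refine b.ext fun j => ?_
      rcases eq_or_ne j i with rfl | hij
      · simp [h]
      · simp [h, hij]
    simpa using LinearMap.congr_fun this v
  ext v
  rw [Module.End.mem_eigenspace_iff, b.mem_span_image, b.ext_elem_iff]
  refine forall_congr' fun i => ?_
  simp only [hrepr, map_smul, Finsupp.smul_apply, smul_eq_mul, Finset.mem_coe,
    Finsupp.mem_support_iff, Set.mem_ofPred_eq]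
  rw [mul_eq_mul_right_iff]
  tauto

theorem hasEigenvalue_iff_of_basis {K V ι : Type*} [Field K] [AddCommGroup V] [Module K V]
    (b : Module.Basis ι K V) (S : V →ₗ[K] V) (c : ι → K) (h : ∀ i, S (b i) = c i • b i) (μ : K) :
    Module.End.HasEigenvalue S μ ↔ ∃ i, c i = μ := by
  rw [Module.End.hasEigenvalue_iff, eigenspace_eq_span_of_basis b S c h, Ne,
    Submodule.span_eq_bot]
  simp [b.ne_zero]

/-- The one-sided derivative of a pointwise maximum `F` of finitely many differentiable functions
is the largest one-sided derivative among the functions attaining the maximum at `u`. -/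
theorem hasDirDeriv_of_isGreatest {ι : Type*} [Finite ι] {f : ι → ℝ → ℝ} {f' : ι → ℝ}
    {F : ℝ → ℝ} {u v L : ℝ} (hf : ∀ i, HasDerivAt (f i) (f' i) u)
    (hF : ∀ s, IsGreatest (Set.range fun i => f i s) (F s))
    (hL : IsGreatest ((fun i => v * f' i) '' {i | f i u = F u}) L) :
    HasDirDeriv F u v L := by
  have hq : ∀ i, Tendsto (fun t : ℝ => (1 / t) * (f i (u + t * v) - f i u)) (𝓝[>] 0)
      (𝓝 (v * f' i)) := by
    intro i
    have hline : HasDerivAt (fun t : ℝ => u + t * v) v 0 := by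
      simpa using ((hasDerivAt_id (0 : ℝ)).mul_const v).const_add u
    have h0 : HasDerivAt (f i) (f' i) (u + 0 * v) := by simpa using hf i
    have h := (h0.comp (0 : ℝ) hline).tendsto_slope_zero_right
    simpa [mul_comm v] using h
  refine tendsto_order.2 ⟨fun a ha => ?_, fun a ha => ?_⟩
  · obtain ⟨i, hi, rfl⟩ := hL.1
    filter_upwards [(hq i).eventually (lt_mem_nhds ha), self_mem_nhdsWithin] with t ht htpos
    have htpos : 0 < t := htpos
    refine ht.trans_le ?_
    have hle : f i (u + t * v) ≤ F (u + t * v) := (hF _).2 ⟨i, rfl⟩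
    have hiu : f i u = F u := hi
    rw [hiu]
    gcongr
  · have key : ∀ i, ∀ᶠ t in 𝓝[>] (0 : ℝ), (1 / t) * (f i (u + t * v) - F u) < a := by
      intro i
      by_cases hi : f i u = F u
      · rw [← hi]
        exact (hq i).eventually (gt_mem_nhds ((hL.2 ⟨i, hi, rfl⟩).trans_lt ha))
      · have hlt : f i u < F u := lt_of_le_of_ne ((hF u).2 ⟨i, rfl⟩) hi
        have hc : ContinuousAt (fun t : ℝ => f i (u + t * v) - t * a) 0 := by
          have h0 : ContinuousAt (f i) (u + 0 * v) := by simpa using (hf i).continuousAt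
          exact (ContinuousAt.comp (f := fun t : ℝ => u + t * v) h0 (by fun_prop)).sub
            (by fun_prop)
        have hev := hc.eventually 
          (gt_mem_nhds (show f i (u + 0 * v) - 0 * a < F u by simpa using hlt))
        filter_upwards [nhdsWithin_le_nhds hev, self_mem_nhdsWithin] with t ht htpos
        have htpos : 0 < t := htpos
        rw [one_div, inv_mul_lt_iff₀ htpos]
        linarith
    filter_upwards [eventually_all.2 key] with t ht
    obtain ⟨i, hi⟩ := (hF (u + t * v)).1
    rw [← hi]
    exact ht i

variable {d : ℕ}

theorem rotRe_eq (A : Matrix (Fin d) (Fin d) ℂ) (θ : ℝ) :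
    rotRe A θ = (Real.cos θ : ℂ) • (realPart A : Matrix (Fin d) (Fin d) ℂ) +
      (Real.sin θ : ℂ) • (imaginaryPart A : Matrix (Fin d) (Fin d) ℂ) := by
  have he : Complex.exp (-(Complex.I * (θ : ℂ))) =
      ⟨Real.cos θ, -Real.sin θ⟩ := by
    rw [show -(Complex.I * (θ : ℂ)) = ((-θ : ℝ) : ℂ) * Complex.I by push_cast; ring,
      Complex.exp_mul_I, ← Complex.ofReal_cos, ← Complex.ofReal_sin]
    apply Complex.ext <;> simp [Complex.cos_ofReal_re, Complex.sin_ofReal_re]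
  rw [rotRe, he, realPart_smul]
  ext i j
  simp

theorem rotReDeriv_eq (A : Matrix (Fin d) (Fin d) ℂ) (θ : ℝ) :
    rotReDeriv A θ = (-Real.sin θ : ℂ) • (realPart A : Matrix (Fin d) (Fin d) ℂ) +
      (Real.cos θ : ℂ) • (imaginaryPart A : Matrix (Fin d) (Fin d) ℂ) := by
  ext i j
  simp only [rotReDeriv, rotRe_eq, Matrix.of_apply, Matrix.add_apply, Matrix.smul_apply,
    smul_eq_mul]
  have hc := (Real.hasDerivAt_cos θ).ofReal_comp
  have hs := (Real.hasDerivAt_sin θ).ofReal_comp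
  have := (hc.mul_const ((realPart A : Matrix (Fin d) (Fin d) ℂ) i j)).add
    (hs.mul_const ((imaginaryPart A : Matrix (Fin d) (Fin d) ℂ) i j))
  rw [Complex.ofReal_neg] at this
  exact this.deriv

theorem isSymmetric_rotRe (A : Matrix (Fin d) (Fin d) ℂ) (θ : ℝ) :
    (Matrix.toEuclideanLin (rotRe A θ)).IsSymmetric :=
  Matrix.isSymmetric_toEuclideanLin_iff.2 (realPart _).2

/-- The product rule for `A(t) y(t)`. -/
theorem hasDerivAt_rotRe_apply (A : Matrix (Fin d) (Fin d) ℂ) {θ : ℝ}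
    {y : ℝ → EuclideanSpace ℂ (Fin d)} {y' : EuclideanSpace ℂ (Fin d)} (hy : HasDerivAt y y' θ) :
    HasDerivAt (fun t => Matrix.toEuclideanLin (rotRe A t) (y t))
      (Matrix.toEuclideanLin (rotReDeriv A θ) (y θ) + Matrix.toEuclideanLin (rotRe A θ) y') θ := by
  have hmap : ∀ B : Matrix (Fin d) (Fin d) ℂ,
      HasDerivAt (fun t => Matrix.toEuclideanLin B (y t)) (Matrix.toEuclideanLin B y') θ :=
    fun B => (((Matrix.toEuclideanLin B).toContinuousLinearMap.restrictScalars
      ℝ).hasFDerivAt.comp_hasDerivAt θ hy)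
  have hc := (Real.hasDerivAt_cos θ).ofReal_comp
  have hs := (Real.hasDerivAt_sin θ).ofReal_comp
  have h := (hc.smul (hmap (realPart A))).add (hs.smul (hmap (imaginaryPart A)))
  simp only [rotRe_eq, rotReDeriv_eq, map_add, map_smul, LinearMap.add_apply, LinearMap.smul_apply]
  refine h.congr_deriv ?_
  push_cast
  abel

/-- First-order perturbation of the eigenvalues: within an eigenspace of `A(θ)`, the derivative
`A'(θ)` is diagonal in the eigenvectors `x k θ`. -/
theorem inner_rotReDeriv_eigenvector {ι : Type*} {A : Matrix (Fin d) (Fin d) ℂ}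
    {lam : ι → ℝ → ℝ} {x : ι → ℝ → EuclideanSpace ℂ (Fin d)}
    (heig : ∀ k θ, Matrix.toEuclideanLin (rotRe A θ) (x k θ) = (lam k θ : ℂ) • x k θ)
    {θ : ℝ} {j k : ι} (hlam : DifferentiableAt ℝ (lam k) θ) (hx : DifferentiableAt ℝ (x k) θ)
    (hjk : lam j θ = lam k θ) :
    inner ℂ (x j θ) (Matrix.toEuclideanLin (rotReDeriv A θ) (x k θ)) =
      ((deriv (lam k) θ : ℝ) : ℂ) * inner ℂ (x j θ) (x k θ) := by
  have h1 := hasDerivAt_rotRe_apply A hx.hasDerivAt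
  have h2 := hlam.hasDerivAt.ofReal_comp.smul hx.hasDerivAt
  have h := h1.unique (h2.congr_of_eventuallyEq (.of_forall fun t => heig k t))
  have hin := congrArg (inner ℂ (x j θ)) h
  simp only [inner_add_right, inner_smul_right] at hin
  rw [← isSymmetric_rotRe A θ, heig, inner_smul_left, Complex.conj_ofReal, hjk] at hin
  linear_combination hin

/-- If the vectors `y k` span `X` and satisfy `⟪y j, B (y k)⟫ = c k * ⟪y j, y k⟫`, then they are
eigenvectors of the compression of `B` to `X`, with eigenvalues `c k`. -/
theorem compression_apply_of_span {ι : Type*} (B : Matrix (Fin d) (Fin d) ℂ)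
    {y : ι → EuclideanSpace ℂ (Fin d)} (X : Submodule ℂ (EuclideanSpace ℂ (Fin d)))
    (hX : X = Submodule.span ℂ (Set.range y)) {c : ι → ℂ}
    (h : ∀ j k, inner ℂ (y j) (Matrix.toEuclideanLin B (y k)) = c k * inner ℂ (y j) (y k))
    (k : ι) (w : X) (hw : (w : EuclideanSpace ℂ (Fin d)) = y k) :
    compression B X w = c k • w := by
  apply Subtype.ext
  change X.starProjection (Matrix.toEuclideanLin B w) = c k • (w : EuclideanSpace ℂ (Fin d))
  refine Submodule.eq_starProjection_of_mem_orthogonal (X.smul_mem _ w.2) ?_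
  suffices hle : X ≤ (ℂ ∙ (Matrix.toEuclideanLin B w - c k • (w : EuclideanSpace ℂ (Fin d))))ᗮ from
    (Submodule.mem_orthogonal _ _).2 fun v hv =>
      Submodule.mem_orthogonal_singleton_iff_inner_left.1 (hle hv)
  refine hX.trans_le (Submodule.span_le.2 ?_)
  rintro _ ⟨j, rfl⟩
  rw [SetLike.mem_coe, Submodule.mem_orthogonal_singleton_iff_inner_left, hw, inner_sub_right, h,
    inner_smul_right, sub_self]

end NumRange

theorem corollary2p5 {d : ℕ} (hd : 0 < d) (A : Matrix (Fin d) (Fin d) ℂ)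
    (lam : Fin d → ℝ → ℝ) (x : Fin d → ℝ → EuclideanSpace ℂ (Fin d))
    (hlam : ∀ k θ, AnalyticAt ℝ (lam k) θ)
    (hx : ∀ k θ, AnalyticAt ℝ (x k) θ)
    (horth : ∀ θ, Orthonormal ℂ (fun k => x k θ))
    (heig : ∀ k θ,
      Matrix.toEuclideanLin (NumRange.rotRe A θ) (x k θ) = (lam k θ : ℂ) • x k θ)
    (θ σ : ℝ) (hσ : σ = 1 ∨ σ = -1) :
    NumRange.HasDirDeriv (NumRange.lamMax A) θ σ (NumRange.dirDeriv (NumRange.lamMax A) θ σ) ∧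
    Module.End.HasEigenvalue
      (NumRange.compression (NumRange.rotReDeriv A θ) (NumRange.maxEigenspace A θ))
      (NumRange.extremeValue A θ σ : ℂ) ∧
    Submodule.span ℂ {v | ∃ k, lam k θ = NumRange.lamMax A θ ∧
        deriv (lam k) θ = NumRange.extremeValue A θ σ ∧ v = x k θ} =
      NumRange.extremeEigenspace A θ σ := by
  have : Nonempty (Fin d) := ⟨⟨0, hd⟩⟩
  let b : (s : ℝ) → Module.Basis (Fin d) ℂ (EuclideanSpace ℂ (Fin d)) := fun s =>
    basisOfLinearIndependentOfCardEqFinrank (horth s).linearIndependent (by simp)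
  have hb : ∀ s k, b s k = x k s := fun s k => by simp [b]
  have hbeig : ∀ s k, Matrix.toEuclideanLin (NumRange.rotRe A s) (b s k) =
      (lam k s : ℂ) • b s k := fun s k => by rw [hb, heig]
  have hmax : ∀ s, IsGreatest (Set.range fun k => lam k s) (NumRange.lamMax A s) := by
    intro s
    have hset : {μ : ℝ | Module.End.HasEigenvalue (Matrix.toEuclideanLin (NumRange.rotRe A s))
        (μ : ℂ)} = Set.range fun k => lam k s := by
      ext μ
      rw [Set.mem_ofPred_eq, NumRange.hasEigenvalue_iff_of_basis (b s) _ _ (hbeig s)]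
      simp
    rw [NumRange.lamMax, hset]
    exact ⟨(Set.range_nonempty _).csSup_mem (Set.finite_range _),
      fun _ h => le_csSup (Set.finite_range _).bddAbove h⟩
  -- The one-sided derivative in direction `σ`, as a maximum over the active indices.
  obtain ⟨L, hL⟩ : ∃ L, IsGreatest
      ((fun k => σ * deriv (lam k) θ) '' {k | lam k θ = NumRange.lamMax A θ}) L := by
    obtain ⟨k, hk⟩ := (hmax θ).1
    have hne : ((fun k => σ * deriv (lam k) θ) ''
        {k | lam k θ = NumRange.lamMax A θ}).Nonempty := ⟨_, k, hk, rfl⟩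
    exact ⟨_, hne.csSup_mem (Set.toFinite _), fun _ h => le_csSup (Set.toFinite _).bddAbove h⟩
  have hdir := NumRange.hasDirDeriv_of_isGreatest
    (fun k => (hlam k θ).differentiableAt.hasDerivAt) hmax hL
  have hdL : NumRange.dirDeriv (NumRange.lamMax A) θ σ = L := hdir.limUnder_eq
  have hX : NumRange.maxEigenspace A θ = Submodule.span ℂ (Set.range
      fun k : {k // lam k θ = NumRange.lamMax A θ} => x k θ) := by
    rw [NumRange.maxEigenspace, NumRange.eigenspace_eq_span_of_basis (b θ) _ _ (hbeig θ)]
    congr 1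
    ext v
    simp [hb]
  let b' := (Module.Basis.span ((horth θ).linearIndependent.comp
    (Subtype.val : {k // lam k θ = NumRange.lamMax A θ} → Fin d) Subtype.val_injective)).map
    (LinearEquiv.ofEq _ _ hX.symm)
  have hb' : ∀ k, (b' k : EuclideanSpace ℂ (Fin d)) = x k θ := by
    intro k
    simp [b', Module.Basis.span_apply]
  have hcomp : ∀ k, NumRange.compression (NumRange.rotReDeriv A θ) (NumRange.maxEigenspace A θ)
      (b' k) = ((deriv (lam k) θ : ℝ) : ℂ) • b' k := fun k =>
    NumRange.compression_apply_of_span _ _ hX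
      (c := fun k : {k // lam k θ = NumRange.lamMax A θ} => ((deriv (lam k) θ : ℝ) : ℂ))
      (fun j k => NumRange.inner_rotReDeriv_eigenvector heig (hlam k θ).differentiableAt
        (hx k θ).differentiableAt (j.2.trans k.2.symm)) k _ (hb' k)
  refine ⟨hdL ▸ hdir, ?_, ?_⟩
  · rw [NumRange.hasEigenvalue_iff_of_basis b' _ _ hcomp]
    obtain ⟨k, hk, hkL⟩ := hL.1
    refine ⟨⟨k, hk⟩, ?_⟩
    rw [NumRange.extremeValue, hdL, ← hkL]
    -- `σ * (σ * a) = a` because `σ ^ 2 = 1`.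
    rcases hσ with rfl | rfl <;> simp
  · rw [NumRange.extremeEigenspace, NumRange.eigenspace_eq_span_of_basis b' _ _ hcomp,
      Submodule.map_span, ← Set.image_comp]
    congr 1
    ext v
    simp only [Set.mem_image, Set.mem_ofPred_eq, Function.comp_apply, Submodule.subtype_apply, hb',
      Subtype.exists, Complex.ofReal_inj]
    constructor
    · rintro ⟨k, hk, hk', rfl⟩
      exact ⟨k, hk, hk', rfl⟩
    · rintro ⟨k, hk, hk', rfl⟩
      exact ⟨k, hk, hk', rfl⟩
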